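/- A single cell consists of an edge server and a finite non-empty set $\mathcal I$ of mobile users. The following positive numbers are given: the uplink bandwidth $\omega$, the noise $n_0$, the number $\tau$ of CPU cycles per byte, the CPU resources $\Gamma_E$ of the server, and, for each user $i$, its transmit power $p_i$, channel gain $g_i$, dataset size $D_i$ and weight-vector size $W_i$ (in bytes), CPU resources $\Gamma_i$, and CPU fraction $\gamma_i\in(0,1]$. Put $R_i=\omega\log_2(1+p_ig_i/n_0)$. The server chooses $x_0=(\tilde\omega,\bar\omega)\in\check{\mathcal S}_0=\{\tilde\omega,\bar\omega\ge 0,\ \sum_i\tilde\omega_i\le 1,\ \sum_i\bar\omega_i\le 1\}\subset\mathbb R^{\mathcal I}\times\mathbb R^{\mathcal I}$ (the fractions of the uplink bandwidth for dataset offloading and for weight uploading), and user $i$ chooses the offloading fraction $x_i=\delta_i\in\check{\mathcal S}_i=[0,1]$. Let $$t_i^{\mathrm{local}}=\frac{(1-\delta_i)D_i\tau}{\gamma_i\Gamma_i}+\frac{W_i}{\bar\omega_iR_i},\qquad t_i^{\mathrm{edge}}=\frac{\delta_iD_i}{\tilde\omega_iR_i}+\frac{\sum_{j}\delta_jD_j\tau}{\Gamma_E},$$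 where a transmission over a zero (or negative) bandwidth fraction takes time $+\infty$, or $0$ if nothing is to be sent. Given the actions of the other players, the server minimizes $\Delta t$ over $(x_0,\Delta t)\in\check{\mathcal S}_0\times\mathbb R$ subject to the coupled constraints $t_i^{\mathrm{local}}\le\Delta t$ and $t_i^{\mathrm{edge}}\le\Delta t$ for all $i\in\mathcal I$, and user $i$ minimizes $\Delta t$ over $(\delta_i,\Delta t)\in\check{\mathcal S}_i\times\mathbb R$ subject to $t_i^{\mathrm{local}}\le\Delta t$ and $t_i^{\mathrm{edge}}\le\Delta t$ for this $i$. For each player $p$, and for given actions of the other players in their strategy sets, let $\hat{\mathcal S}_p$ be the set of the pairs $(x_p,\Delta t)$ that satisfy the coupled constraints of $p$. Theorem. In this game, for each player $p$, the set $\check{\mathcal S}_p$ is convex and compact, each set $\hat{\mathcal S}_p$ is closed and convex, and the objective $(x_p,\Delta t)\mapsto\Delta t$ is continuous and convex. The game has a generalized Nash equilibrium: there are actions $(x_p^*)_p$ and a number $\Delta t^*$ such that, for every player $p$, the pair $(x_p^*,\Delta t^*)$ solves the problem of $p$ given the actions $x_q^*$, $q\ne p$, of the others. Moreover, there is such an equilibrium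 with $\tilde\omega_i^*>0$ and $\bar\omega_i^*>0$ for all $i\in\mathcal I$. -/

import Mathlib

/-- The fixed data of a single-cell edge-computing system for federated learning, with one edge
server and the set `ι` of mobile users.  All quantities are positive, and the CPU fraction `γ i`,
which is given in the time-minimization game, lies in `(0, 1]`. -/
structure MECSystem (ι : Type*) where
  /-- total uplink bandwidth `ω` -/
  bandwidth : ℝ
  /-- noise `n₀` -/
  noise : ℝ
  /-- transmit power `p i` of user `i` -/
  power : ι → ℝ
  /-- uplink channel gain `g i` of user `i` -/
  gain : ι → ℝ
  /-- size in bytes of the local dataset of user `i` -/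
  dataBytes : ι → ℝ
  /-- size in bytes of the weight vector of user `i` -/
  weightBytes : ι → ℝ
  /-- number `τ` of CPU cycles needed to train on one byte -/
  cyclesPerByte : ℝ
  /-- CPU resources `Γ i` of user `i` -/
  cpu : ι → ℝ
  /-- fraction `γ i` of its CPU resources that user `i` devotes to the training -/
  cpuFraction : ι → ℝ
  /-- CPU resources of the edge server -/
  edgeCpu : ℝ
  bandwidth_pos : 0 < bandwidth
  noise_pos : 0 < noise
  power_pos : ∀ i, 0 < power i
  gain_pos : ∀ i, 0 < gain i
  dataBytes_pos : ∀ i, 0 < dataBytes i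
  weightBytes_pos : ∀ i, 0 < weightBytes i
  cyclesPerByte_pos : 0 < cyclesPerByte
  cpu_pos : ∀ i, 0 < cpu i
  cpuFraction_pos : ∀ i, 0 < cpuFraction i
  cpuFraction_le_one : ∀ i, cpuFraction i ≤ 1
  edgeCpu_pos : 0 < edgeCpu

/-- Time needed to send `size` bytes at rate `rate`.  Without a positive rate, sending something
takes infinitely long, and sending nothing takes no time. -/
noncomputable def transmissionTime (size rate : ℝ) : EReal :=
  if 0 < rate then ((size / rate : ℝ) : EReal) else if size = 0 then 0 else ⊤

/-- A profile of actions: the action of the edge server is the pair `(offBW, upBW)` of vectors of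
uplink bandwidth fractions, for dataset offloading and for weight uploading; the action of user `i`
is the fraction `offload i` of its dataset that it offloads. -/
structure Profile (ι : Type*) where
  offBW : ι → ℝ
  upBW : ι → ℝ
  offload : ι → ℝ

namespace MECSystem

variable {ι : Type*} [Fintype ι] [DecidableEq ι]

/-- Data rate of user `i` over the full bandwidth. -/
noncomputable def rate (M : MECSystem ι) (i : ι) : ℝ :=
  M.bandwidth * Real.logb 2 (1 + M.power i * M.gain i / M.noise)

/-- Local time of user `i`: training on the part of the dataset that it keeps, then uploading its
weight vector; `δ` is its offloading fraction and `w` its bandwidth fraction for weight uploading. -/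
noncomputable def localTime (M : MECSystem ι) (i : ι) (δ w : ℝ) : EReal :=
  (((1 - δ) * M.dataBytes i * M.cyclesPerByte / (M.cpuFraction i * M.cpu i) : ℝ) : EReal)
    + transmissionTime (M.weightBytes i) (w * M.rate i)

/-- Edge time of user `i`: offloading its own data, then training at the edge server on the data
offloaded by all users; `v` is the bandwidth fraction of user `i` for dataset offloading. -/
noncomputable def edgeTime (M : MECSystem ι) (i : ι) (δ : ι → ℝ) (v : ℝ) : EReal :=
  transmissionTime (δ i * M.dataBytes i) (v * M.rate i)
    + (((∑ j, δ j * M.dataBytes j * M.cyclesPerByte) / M.edgeCpu : ℝ) : EReal)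

/-- Own strategy set of the edge server. -/
def serverSet (ι : Type*) [Fintype ι] : Set ((ι → ℝ) × (ι → ℝ)) :=
  {y | ∑ i, y.1 i ≤ 1 ∧ ∑ i, y.2 i ≤ 1 ∧ (∀ i, 0 ≤ y.1 i) ∧ ∀ i, 0 ≤ y.2 i}

/-- Own strategy set of a user. -/
def userSet : Set ℝ := Set.Icc 0 1

/-- Coupled constraint set of the edge server, given the offloading fractions `δ` of the users:
the pairs of an action and a value of `Δt` such that the local time and the edge time
of every user are at most `Δt`. -/
def serverCoupledSet (M : MECSystem ι) (δ : ι → ℝ) : Set (((ι → ℝ) × (ι → ℝ)) × ℝ) :=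
  {z | ∀ i, M.localTime i (δ i) (z.1.2 i) ≤ (z.2 : EReal) ∧
    M.edgeTime i δ (z.1.1 i) ≤ (z.2 : EReal)}

/-- Coupled constraint set of user `i`, given the actions of the other players in `x` (the entry
`x.offload i` is overwritten): the pairs of an offloading fraction and a value of `Δt` such
that the local time and the edge time of user `i` are at most `Δt`. -/
def userCoupledSet (M : MECSystem ι) (x : Profile ι) (i : ι) : Set (ℝ × ℝ) :=
  {z | M.localTime i z.1 (x.upBW i) ≤ (z.2 : EReal) ∧
    M.edgeTime i (Function.update x.offload i z.1) (x.offBW i) ≤ (z.2 : EReal)}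

/-- The objective `Δt` that a player with actions in `X` minimizes, as a function of its
action and of the bound `Δt`. -/
def objective (X : Type*) (z : X × ℝ) : ℝ := z.2

/-- `z` solves the problem of minimizing `Δt` over the own strategy set `S`, subject to the
coupled constraints `C`. -/
def Solves {X : Type*} (S : Set X) (C : Set (X × ℝ)) (z : X × ℝ) : Prop :=
  (z.1 ∈ S ∧ z ∈ C) ∧ IsMinOn (objective X) {y | y.1 ∈ S ∧ y ∈ C} z

/-- Generalized Nash equilibrium of the time-minimization game, with equilibrium time `T`: given the
actions of the others, the action of each player together with `Δt = T` solves the problem of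
that player. -/
def IsGNE (M : MECSystem ι) (x : Profile ι) (T : ℝ) : Prop :=
  Solves (serverSet ι) (M.serverCoupledSet x.offload) ((x.offBW, x.upBW), T) ∧
    ∀ i, Solves userSet (M.userCoupledSet x i) (x.offload i, T)

end MECSystem

open Set

/-! No fixed-point theorem is needed, because every profile of offloading fractions in `(0, 1]`
extends to an equilibrium. With the fractions fixed, each target time `T` determines the bandwidth
shares that make every local and edge time equal to `T`. Take the smallest `T` for which both
bandwidth budgets suffice; one budget is then used up. A server aiming below `T` would have to
enlarge every share of that budget (`solves_server_of_times_eq`). A user who offloads less raises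
its local time, and one who offloads more raises its edge time (`solves_user_of_times_eq`).

The coupled constraint sets are intersections of preimages, under affine maps, of the region where a
transmission time is at most `t`. For the server the size is fixed, and the region is a half-plane
or is bounded by a hyperbola. For a user the rate is fixed, and the region is a half-plane or a ray.
-/

/-! ### Transmission-time constraints -/

lemma transmissionTime_of_pos {s r : ℝ} (hr : 0 < r) :
    transmissionTime s r = ((s / r : ℝ) : EReal) := if_pos hr

lemma transmissionTime_of_nonpos {s r : ℝ} (hr : r ≤ 0) (hs : s ≠ 0) :
    transmissionTime s r = ⊤ := by
  rw [transmissionTime, if_neg hr.not_gt, if_neg hs]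

lemma transmissionTime_zero (r : ℝ) : transmissionTime 0 r = 0 := by
  simp [transmissionTime]

lemma transmissionTime_le_iff_of_rate_pos {s r t : ℝ} (hr : 0 < r) :
    transmissionTime s r ≤ (t : EReal) ↔ s ≤ r * t := by
  rw [transmissionTime_of_pos hr, EReal.coe_le_coe_iff, div_le_iff₀' hr]

lemma transmissionTime_le_iff_of_rate_nonpos {s r t : ℝ} (hr : r ≤ 0) :
    transmissionTime s r ≤ (t : EReal) ↔ s = 0 ∧ 0 ≤ t := by
  by_cases hs : s = 0
  · simp [hs, transmissionTime_zero]
  · simp [transmissionTime_of_nonpos hr hs, hs]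

lemma transmissionTime_le_iff_of_size_pos {s r t : ℝ} (hs : 0 < s) :
    transmissionTime s r ≤ (t : EReal) ↔ 0 ≤ r ∧ 0 ≤ t ∧ s ≤ r * t := by
  rcases lt_or_ge 0 r with hr | hr
  · rw [transmissionTime_le_iff_of_rate_pos hr]
    exact ⟨fun h => ⟨hr.le, (pos_of_mul_pos_right (hs.trans_le h) hr.le).le, h⟩, fun h => h.2.2⟩
  · rw [transmissionTime_of_nonpos hr hs.ne']
    refine ⟨fun h => by simp at h, fun ⟨_, h2, h3⟩ => ?_⟩
    exact absurd (h3.trans (mul_nonpos_of_nonpos_of_nonneg hr h2)) hs.not_ge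

/-- The summand `a` is finite, so it can be moved across even when the transmission time is `⊤`.
This reduces each coupled constraint to one on a transmission time alone. -/
lemma coe_add_transmissionTime_le_iff {a s r t : ℝ} :
    (a : EReal) + transmissionTime s r ≤ (t : EReal) ↔
      transmissionTime s r ≤ ((t - a : ℝ) : EReal) := by
  unfold transmissionTime
  split_ifs
  · rw [← EReal.coe_add, EReal.coe_le_coe_iff, EReal.coe_le_coe_iff, le_sub_iff_add_le']
  · rw [add_zero, EReal.coe_le_coe_iff, ← EReal.coe_zero, EReal.coe_le_coe_iff, sub_nonneg]
  · simp only [EReal.coe_add_top, top_le_iff, EReal.coe_ne_top]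

/-- For points of a hyperbolic region `s ≤ r * t` in the positive quadrant, the mixed products are
at least `2 * s` together. -/
lemma two_mul_le_mul_add_mul {s r t r' t' : ℝ} (hs : 0 ≤ s) (hr : 0 ≤ r) (ht : 0 ≤ t)
    (hr' : 0 ≤ r') (ht' : 0 ≤ t') (h : s ≤ r * t) (h' : s ≤ r' * t') :
    2 * s ≤ r * t' + r' * t := by
  refine le_of_sq_le_sq ?_ (by positivity)
  have := mul_le_mul h h' hs (by positivity)
  -- AM-GM: the squared sum is at least `4 * (r * t') * (r' * t)`, which regroups as `4 * (r * t) *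
  -- (r' * t') ≥ 4 * s ^ 2`.
  nlinarith [sq_nonneg (r * t' - r' * t)]

lemma convex_transmissionTime_le_of_size_nonneg {s : ℝ} (hs : 0 ≤ s) :
    Convex ℝ {q : ℝ × ℝ | transmissionTime s q.1 ≤ (q.2 : EReal)} := by
  rcases hs.eq_or_lt with rfl | hs
  · simp only [transmissionTime_zero, EReal.coe_nonneg]
    exact convex_halfSpace_ge (LinearMap.snd ℝ ℝ ℝ).isLinear 0
  · simp only [transmissionTime_le_iff_of_size_pos hs]
    rintro ⟨r, t⟩ ⟨hr, ht, h⟩ ⟨r', t'⟩ ⟨hr', ht', h'⟩ a b ha hb hab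
    simp only [Prod.smul_mk, Prod.mk_add_mk, smul_eq_mul, mem_ofPred_eq] at *
    refine ⟨by positivity, by positivity, ?_⟩
    have h2 := two_mul_le_mul_add_mul hs.le hr ht hr' ht' h h'
    calc s = a * a * s + b * b * s + a * b * (2 * s) := by
          rw [show b = 1 - a by linarith]; ring
      _ ≤ a * a * (r * t) + b * b * (r' * t') + a * b * (r * t' + r' * t) := by gcongr
      _ = _ := by ring

lemma isClosed_transmissionTime_le_of_size_nonneg {s : ℝ} (hs : 0 ≤ s) :
    IsClosed {q : ℝ × ℝ | transmissionTime s q.1 ≤ (q.2 : EReal)} := by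
  rcases hs.eq_or_lt with rfl | hs
  · simp only [transmissionTime_zero, EReal.coe_nonneg]
    exact isClosed_le continuous_const continuous_snd
  · simp only [transmissionTime_le_iff_of_size_pos hs]
    exact (isClosed_le continuous_const continuous_fst).inter
      ((isClosed_le continuous_const continuous_snd).inter
        (isClosed_le continuous_const (continuous_fst.mul continuous_snd)))

lemma convex_transmissionTime_le_of_rate (r : ℝ) :
    Convex ℝ {q : ℝ × ℝ | transmissionTime q.1 r ≤ (q.2 : EReal)} := by
  rcases lt_or_ge 0 r with hr | hr
  · simp only [transmissionTime_le_iff_of_rate_pos hr]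
    rintro ⟨s, t⟩ h ⟨s', t'⟩ h' a b ha hb hab
    simp only [Prod.smul_mk, Prod.mk_add_mk, smul_eq_mul, mem_ofPred_eq] at *
    linarith [mul_le_mul_of_nonneg_left h ha, mul_le_mul_of_nonneg_left h' hb]
  · simp only [transmissionTime_le_iff_of_rate_nonpos hr]
    rintro ⟨s, t⟩ ⟨h, ht⟩ ⟨s', t'⟩ ⟨h', ht'⟩ a b ha hb hab
    simp only [Prod.smul_mk, Prod.mk_add_mk, smul_eq_mul, mem_ofPred_eq] at *
    exact ⟨by simp [h, h'], by positivity⟩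

lemma isClosed_transmissionTime_le_of_rate (r : ℝ) :
    IsClosed {q : ℝ × ℝ | transmissionTime q.1 r ≤ (q.2 : EReal)} := by
  rcases lt_or_ge 0 r with hr | hr
  · simp only [transmissionTime_le_iff_of_rate_pos hr]
    exact isClosed_le continuous_fst (continuous_const.mul continuous_snd)
  · simp only [transmissionTime_le_iff_of_rate_nonpos hr]
    exact (isClosed_eq continuous_fst continuous_const).inter
      (isClosed_le continuous_const continuous_snd)

/-- Compatibility is asked only for `a + b = 1`, so affine maps given as bare functions qualify. -/
lemma Convex.preimage_of_map_combo {E F : Type*} [AddCommGroup E] [Module ℝ E] [AddCommGroup F]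
    [Module ℝ F] {f : E → F} {S : Set F} (hS : Convex ℝ S)
    (hf : ∀ x y : E, ∀ a b : ℝ, a + b = 1 → f (a • x + b • y) = a • f x + b • f y) :
    Convex ℝ (f ⁻¹' S) := by
  intro x hx y hy a b ha hb hab
  rw [mem_preimage, hf x y a b hab]
  exact hS hx hy ha hb hab

/-! ### The time at which a bandwidth budget is used up -/

/-- Intermediate value theorem, with `A k` maximal. At `A k + b k` the `k`-th term alone equals `1`;
at `A k + ∑ i, b i` every denominator is at least `∑ i, b i`. -/
lemma exists_gt_sum_div_sub_eq_one {ι : Type*} [Fintype ι] [Nonempty ι] (A b : ι → ℝ)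
    (hb : ∀ i, 0 < b i) : ∃ T, (∀ i, A i < T) ∧ ∑ i, b i / (T - A i) = 1 := by
  obtain ⟨k, hk⟩ := Finite.exists_max A
  have hpos : ∀ T, A k + b k ≤ T → ∀ i, 0 < T - A i := fun T hT i => by
    linarith [hk i, hb k]
  have hsum : b k ≤ ∑ i, b i :=
    Finset.single_le_sum (fun i _ => (hb i).le) (Finset.mem_univ k)
  have hsum0 : 0 < ∑ i, b i := (hb k).trans_le hsum
  have hcont : ContinuousOn (fun T => ∑ i, b i / (T - A i)) (Icc (A k + b k) (A k + ∑ i, b i)) :=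
    continuousOn_finsetSum _ fun i _ => continuousOn_const.div
      (continuousOn_id.sub continuousOn_const) fun T hT => (hpos T hT.1 i).ne'
  have hlo : 1 ≤ ∑ i, b i / (A k + b k - A i) := by
    refine le_trans ?_ (Finset.single_le_sum (f := fun i => b i / (A k + b k - A i))
      (fun i _ => (div_pos (hb i) (hpos _ le_rfl i)).le) (Finset.mem_univ k))
    simp [(hb k).ne']
  have hhi : ∑ i, b i / (A k + ∑ i, b i - A i) ≤ 1 := by
    rw [← div_self hsum0.ne', Finset.sum_div]
    refine Finset.sum_le_sum fun i _ => div_le_div_of_nonneg_left (hb i).le hsum0 ?_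
    linarith [hk i]
  obtain ⟨T, hT, h1⟩ := intermediate_value_Icc' (by linarith) hcont ⟨hhi, hlo⟩
  exact ⟨T, fun i => sub_pos.mp (hpos T hT.1 i), h1⟩

/-! ### Strategy sets and objective -/

namespace MECSystem

section StrategySets

variable {ι : Type*} [Fintype ι]

lemma convex_serverSet : Convex ℝ (serverSet ι) := by
  rintro x ⟨h1, h2, h3, h4⟩ y ⟨k1, k2, k3, k4⟩ a b ha hb hab
  simp only [serverSet, mem_ofPred_eq, Prod.fst_add, Prod.snd_add, Prod.smul_fst, Prod.smul_snd,
    Pi.add_apply, Pi.smul_apply, smul_eq_mul, Finset.sum_add_distrib, ← Finset.mul_sum]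
  refine ⟨?_, ?_, fun i => ?_, fun i => ?_⟩
  · linarith [mul_le_mul_of_nonneg_left h1 ha, mul_le_mul_of_nonneg_left k1 hb]
  · linarith [mul_le_mul_of_nonneg_left h2 ha, mul_le_mul_of_nonneg_left k2 hb]
  · exact add_nonneg (mul_nonneg ha (h3 i)) (mul_nonneg hb (k3 i))
  · exact add_nonneg (mul_nonneg ha (h4 i)) (mul_nonneg hb (k4 i))

lemma isCompact_serverSet : IsCompact (serverSet ι) := by
  have hclosed : IsClosed (serverSet ι) := by
    have h : ∀ f : (ι → ℝ) × (ι → ℝ) → ι → ℝ, Continuous f →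
        IsClosed {y | ∑ i, f y i ≤ 1} ∧ IsClosed {y | ∀ i, 0 ≤ f y i} := fun f hf => by
      refine ⟨isClosed_le (by fun_prop) continuous_const, ?_⟩
      simp only [ofPred_forall]
      exact isClosed_iInter fun i => isClosed_le continuous_const (by fun_prop)
    exact (h _ continuous_fst).1.inter ((h _ continuous_snd).1.inter
      ((h _ continuous_fst).2.inter (h _ continuous_snd).2))
  have hcube : IsCompact (Icc (0 : ι → ℝ) 1 ×ˢ Icc (0 : ι → ℝ) 1) := isCompact_Icc.prod isCompact_Icc
  refine hcube.of_isClosed_subset hclosed ?_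
  rintro y ⟨h1, h2, h3, h4⟩
  exact ⟨⟨h3, fun i => (Finset.single_le_sum (fun j _ => h3 j) (Finset.mem_univ i)).trans h1⟩,
    ⟨h4, fun i => (Finset.single_le_sum (fun j _ => h4 j) (Finset.mem_univ i)).trans h2⟩⟩

lemma continuous_objective (X : Type*) [TopologicalSpace X] : Continuous (objective X) :=
  continuous_snd

lemma convexOn_objective (X : Type*) [AddCommGroup X] [Module ℝ X] :
    ConvexOn ℝ univ (objective X) :=
  (LinearMap.snd ℝ X ℝ).convexOn convex_univ

end StrategySets

/-! ### Training times and local times -/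

variable {ι : Type*} (M : MECSystem ι)

/-- Time to train locally on the part of the dataset that is not offloaded. -/
noncomputable def localTraining (i : ι) (δ : ℝ) : ℝ :=
  (1 - δ) * M.dataBytes i * M.cyclesPerByte / (M.cpuFraction i * M.cpu i)

/-- Time for which the edge server trains on all the offloaded data. -/
noncomputable def edgeTraining [Fintype ι] (δ : ι → ℝ) : ℝ :=
  (∑ j, δ j * M.dataBytes j * M.cyclesPerByte) / M.edgeCpu

lemma localTraining_lt {i : ι} {δ δ' : ℝ} (h : δ < δ') :
    M.localTraining i δ' < M.localTraining i δ := by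
  have h1 := M.dataBytes_pos i
  have h2 := M.cyclesPerByte_pos
  have h3 := M.cpuFraction_pos i
  have h4 := M.cpu_pos i
  unfold localTraining
  gcongr

lemma localTraining_combo (i : ι) (δ δ' a b : ℝ) (hab : a + b = 1) :
    M.localTraining i (a * δ + b * δ') = a * M.localTraining i δ + b * M.localTraining i δ' := by
  unfold localTraining
  rw [show b = 1 - a by linarith]
  ring

lemma rate_pos (i : ι) : 0 < M.rate i := by
  have h : 0 < M.power i * M.gain i / M.noise :=
    div_pos (mul_pos (M.power_pos i) (M.gain_pos i)) M.noise_pos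
  exact mul_pos M.bandwidth_pos (Real.logb_pos (by norm_num) (by linarith))

lemma localTime_le_iff {i : ι} {δ w t : ℝ} :
    M.localTime i δ w ≤ (t : EReal) ↔
      transmissionTime (M.weightBytes i) (w * M.rate i) ≤
        ((t - M.localTraining i δ : ℝ) : EReal) :=
  coe_add_transmissionTime_le_iff

lemma localTime_eq_of_pos {i : ι} {δ w : ℝ} (hw : 0 < w) :
    M.localTime i δ w =
      ((M.localTraining i δ + M.weightBytes i / (w * M.rate i) : ℝ) : EReal) := by
  rw [localTime, transmissionTime_of_pos (mul_pos hw (M.rate_pos i)), ← EReal.coe_add]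
  rfl

/-- A local time below `T` takes more than the uplink bandwidth for which it equals `T`. -/
lemma lt_of_localTime_lt {i : ι} {δ w w' T T' : ℝ} (hw : 0 < w)
    (h : M.localTime i δ w = (T : EReal)) (h' : M.localTime i δ w' ≤ (T' : EReal)) (hT : T' < T) :
    w < w' := by
  have hR := M.rate_pos i
  have hW := M.weightBytes_pos i
  rw [localTime_eq_of_pos M hw, EReal.coe_eq_coe_iff] at h
  rw [localTime_le_iff, transmissionTime_le_iff_of_size_pos hW] at h'
  obtain ⟨h1, h2, h3⟩ := h'
  have hw' : 0 < w' := by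
    by_contra hn
    nlinarith [mul_nonneg (mul_nonneg (neg_nonneg.mpr (not_lt.mp hn)) hR.le) h2]
  by_contra! hle
  have : M.weightBytes i / (w * M.rate i) ≤ M.weightBytes i / (w' * M.rate i) := by gcongr
  have h4 : M.weightBytes i / (w' * M.rate i) ≤ T' - M.localTraining i δ := by
    rwa [div_le_iff₀' (mul_pos hw' hR)]
  linarith

/-! ### Coupled constraint sets -/

variable [Fintype ι]

lemma edgeTime_le_iff {i : ι} {δ : ι → ℝ} {v t : ℝ} :
    M.edgeTime i δ v ≤ (t : EReal) ↔
      transmissionTime (δ i * M.dataBytes i) (v * M.rate i) ≤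
        ((t - M.edgeTraining δ : ℝ) : EReal) := by
  rw [edgeTime, add_comm]
  exact coe_add_transmissionTime_le_iff

lemma serverCoupledSet_eq (δ : ι → ℝ) :
    M.serverCoupledSet δ = ⋂ i,
      (fun z : ((ι → ℝ) × (ι → ℝ)) × ℝ => (z.1.2 i * M.rate i, z.2 - M.localTraining i (δ i))) ⁻¹'
        {q : ℝ × ℝ | transmissionTime (M.weightBytes i) q.1 ≤ (q.2 : EReal)} ∩
      (fun z : ((ι → ℝ) × (ι → ℝ)) × ℝ => (z.1.1 i * M.rate i, z.2 - M.edgeTraining δ)) ⁻¹'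
        {q : ℝ × ℝ | transmissionTime (δ i * M.dataBytes i) q.1 ≤ (q.2 : EReal)} := by
  ext z
  simp [serverCoupledSet, localTime_le_iff, edgeTime_le_iff]

/-- Nonnegative fractions matter: for a negative size the region contains points with rate tending
to `0` from above, but not their limit. -/
lemma isClosed_serverCoupledSet {δ : ι → ℝ} (hδ : ∀ i, 0 ≤ δ i) :
    IsClosed (M.serverCoupledSet δ) := by
  rw [serverCoupledSet_eq]
  refine isClosed_iInter fun i => IsClosed.inter ?_ ?_
  · exact (isClosed_transmissionTime_le_of_size_nonneg (M.weightBytes_pos i).le).preimage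
      (by fun_prop)
  · exact (isClosed_transmissionTime_le_of_size_nonneg
      (mul_nonneg (hδ i) (M.dataBytes_pos i).le)).preimage (by fun_prop)

lemma convex_serverCoupledSet {δ : ι → ℝ} (hδ : ∀ i, 0 ≤ δ i) :
    Convex ℝ (M.serverCoupledSet δ) := by
  rw [serverCoupledSet_eq]
  refine convex_iInter fun i => Convex.inter ?_ ?_
  · refine (convex_transmissionTime_le_of_size_nonneg
      (M.weightBytes_pos i).le).preimage_of_map_combo fun x y a b hab => ?_
    obtain rfl : b = 1 - a := by linarith
    ext <;> simp <;> ring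
  · refine (convex_transmissionTime_le_of_size_nonneg
      (mul_nonneg (hδ i) (M.dataBytes_pos i).le)).preimage_of_map_combo fun x y a b hab => ?_
    obtain rfl : b = 1 - a := by linarith
    ext <;> simp <;> ring

section Update

variable [DecidableEq ι]

/-- Shows the dependence on one user's fraction to be affine with positive slope: affinity makes
that user's constraint set closed and convex, and the slope penalizes offloading more. -/
lemma edgeTraining_update (δ : ι → ℝ) (i : ι) (d : ℝ) :
    M.edgeTraining (Function.update δ i d) =
      M.edgeTraining δ + (d - δ i) * (M.dataBytes i * M.cyclesPerByte / M.edgeCpu) := by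
  have h : ∀ j, Function.update δ i d j * M.dataBytes j * M.cyclesPerByte =
      δ j * M.dataBytes j * M.cyclesPerByte +
        if j = i then (d - δ i) * M.dataBytes i * M.cyclesPerByte else 0 := by
    intro j
    by_cases hj : j = i
    · subst hj; simp; ring
    · simp [hj]
  unfold edgeTraining
  simp only [h, Finset.sum_add_distrib, Finset.sum_ite_eq', Finset.mem_univ, if_true]
  ring

lemma userCoupledSet_eq (x : Profile ι) (i : ι) :
    M.userCoupledSet x i =
      (fun z : ℝ × ℝ => (M.weightBytes i, z.2 - M.localTraining i z.1)) ⁻¹'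
        {q : ℝ × ℝ | transmissionTime q.1 (x.upBW i * M.rate i) ≤ (q.2 : EReal)} ∩
      (fun z : ℝ × ℝ => (z.1 * M.dataBytes i,
          z.2 - M.edgeTraining (Function.update x.offload i z.1))) ⁻¹'
        {q : ℝ × ℝ | transmissionTime q.1 (x.offBW i * M.rate i) ≤ (q.2 : EReal)} := by
  ext z
  simp [userCoupledSet, localTime_le_iff, edgeTime_le_iff]

lemma isClosed_userCoupledSet (x : Profile ι) (i : ι) : IsClosed (M.userCoupledSet x i) := by
  rw [userCoupledSet_eq]
  refine IsClosed.inter ?_ ?_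
  · refine (isClosed_transmissionTime_le_of_rate _).preimage ?_
    unfold localTraining
    fun_prop
  · refine (isClosed_transmissionTime_le_of_rate _).preimage ?_
    simp only [edgeTraining_update]
    fun_prop

lemma convex_userCoupledSet (x : Profile ι) (i : ι) : Convex ℝ (M.userCoupledSet x i) := by
  rw [userCoupledSet_eq]
  refine Convex.inter ?_ ?_
  · refine (convex_transmissionTime_le_of_rate _).preimage_of_map_combo fun y z a b hab => ?_
    ext
    · simp [← add_mul, hab]
    · simp [M.localTraining_combo i _ _ a b hab]
      ring
  · refine (convex_transmissionTime_le_of_rate _).preimage_of_map_combo fun y z a b hab => ?_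
    obtain rfl : b = 1 - a := by linarith
    ext <;> simp [edgeTraining_update] <;> ring

end Update

/-! ### Equalized times and the equilibrium -/

lemma edgeTime_eq_of_pos {i : ι} {δ : ι → ℝ} {v : ℝ} (hv : 0 < v) :
    M.edgeTime i δ v =
      ((δ i * M.dataBytes i / (v * M.rate i) + M.edgeTraining δ : ℝ) : EReal) := by
  rw [edgeTime, transmissionTime_of_pos (mul_pos hv (M.rate_pos i)), ← EReal.coe_add]
  rfl

/-- An edge time below `T` takes more than the uplink bandwidth for which it equals `T`. -/
lemma lt_of_edgeTime_lt {i : ι} {δ : ι → ℝ} {v v' T T' : ℝ} (hδ : 0 < δ i) (hv : 0 < v)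
    (h : M.edgeTime i δ v = (T : EReal)) (h' : M.edgeTime i δ v' ≤ (T' : EReal)) (hT : T' < T) :
    v < v' := by
  have hR := M.rate_pos i
  have hD := mul_pos hδ (M.dataBytes_pos i)
  rw [edgeTime_eq_of_pos M hv, EReal.coe_eq_coe_iff] at h
  rw [edgeTime_le_iff, transmissionTime_le_iff_of_size_pos hD] at h'
  obtain ⟨h1, h2, h3⟩ := h'
  have hv' : 0 < v' := by
    by_contra hn
    nlinarith [mul_nonneg (mul_nonneg (neg_nonneg.mpr (not_lt.mp hn)) hR.le) h2]
  by_contra! hle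
  have : δ i * M.dataBytes i / (v * M.rate i) ≤ δ i * M.dataBytes i / (v' * M.rate i) := by gcongr
  have h4 : δ i * M.dataBytes i / (v' * M.rate i) ≤ T' - M.edgeTraining δ := by
    rwa [div_le_iff₀' (mul_pos hv' hR)]
  linarith

/-- If all local and edge times equal `T`, the server can lower them only by exceeding
its bandwidth, as soon as the bandwidth for one of the two purposes is used up. -/
lemma solves_server_of_times_eq [Nonempty ι] {x : Profile ι} {T : ℝ} (hδ : ∀ i, 0 < x.offload i)
    (hx : (x.offBW, x.upBW) ∈ serverSet ι)
    (hv : ∀ i, 0 < x.offBW i) (hw : ∀ i, 0 < x.upBW i)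
    (hl : ∀ i, M.localTime i (x.offload i) (x.upBW i) = (T : EReal))
    (he : ∀ i, M.edgeTime i x.offload (x.offBW i) = (T : EReal))
    (hfull : ∑ i, x.offBW i = 1 ∨ ∑ i, x.upBW i = 1) :
    Solves (serverSet ι) (M.serverCoupledSet x.offload) ((x.offBW, x.upBW), T) := by
  refine ⟨⟨hx, fun i => ⟨(hl i).le, (he i).le⟩⟩, ?_⟩
  rintro ⟨⟨v', w'⟩, T'⟩ ⟨⟨hv', hw', -, -⟩, hC⟩
  change T ≤ T'
  by_contra! hT
  rcases hfull with h | h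
  · refine absurd hv' (not_le.mpr (h ▸ ?_))
    exact Finset.sum_lt_sum_of_nonempty Finset.univ_nonempty fun i _ =>
      M.lt_of_edgeTime_lt (hδ i) (hv i) (he i) (hC i).2 hT
  · refine absurd hw' (not_le.mpr (h ▸ ?_))
    exact Finset.sum_lt_sum_of_nonempty Finset.univ_nonempty fun i _ =>
      M.lt_of_localTime_lt (hw i) (hl i) (hC i).1 hT

variable [DecidableEq ι]

/-- A user whose local time and edge time both equal `T` cannot lower both. -/
lemma solves_user_of_times_eq {x : Profile ι} {T : ℝ} {i : ι} (hδ : x.offload i ∈ userSet)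
    (hv : 0 < x.offBW i) (hw : 0 < x.upBW i)
    (hl : M.localTime i (x.offload i) (x.upBW i) = (T : EReal))
    (he : M.edgeTime i x.offload (x.offBW i) = (T : EReal)) :
    Solves userSet (M.userCoupledSet x i) (x.offload i, T) := by
  refine ⟨⟨hδ, hl.le, ?_⟩, ?_⟩
  · simp only [Function.update_eq_self]
    exact he.le
  rintro ⟨d, T'⟩ ⟨-, h1, h2⟩
  change T ≤ T'
  rw [localTime_eq_of_pos M hw, EReal.coe_eq_coe_iff] at hl
  rw [edgeTime_eq_of_pos M hv, EReal.coe_eq_coe_iff] at he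
  simp only [localTime_eq_of_pos M hw, EReal.coe_le_coe_iff] at h1
  simp only [edgeTime_eq_of_pos M hv, EReal.coe_le_coe_iff, edgeTraining_update,
    Function.update_self] at h2
  -- A smaller fraction lengthens local training at unchanged upload time; a larger one lengthens
  -- both parts of the edge time.
  rcases le_or_gt d (x.offload i) with hd | hd
  · rcases hd.eq_or_lt with rfl | hd
    · linarith
    · linarith [M.localTraining_lt (i := i) hd]
  · have hr := M.rate_pos i
    have hD := M.dataBytes_pos i
    have h3 : x.offload i * M.dataBytes i / (x.offBW i * M.rate i) ≤
        d * M.dataBytes i / (x.offBW i * M.rate i) := by gcongr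
    have h4 : 0 < (d - x.offload i) * (M.dataBytes i * M.cyclesPerByte / M.edgeCpu) :=
      mul_pos (sub_pos.mpr hd) (div_pos (mul_pos hD M.cyclesPerByte_pos) M.edgeCpu_pos)
    linarith

/-- Every profile of positive offloading fractions belongs to an equilibrium, in which the server
equalizes all local and edge times. -/
theorem exists_isGNE_of_offload [Nonempty ι] (δ : ι → ℝ) (hδ : ∀ i, 0 < δ i) (hδ1 : ∀ i, δ i ≤ 1) :
    ∃ (x : Profile ι) (T : ℝ), x.offload = δ ∧ M.IsGNE x T ∧
      ∀ i, 0 < x.offBW i ∧ 0 < x.upBW i := by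
  have hR := M.rate_pos
  set A : ι → ℝ := fun i => M.localTraining i (δ i) with hA
  set E := M.edgeTraining δ with hE
  set b : ι → ℝ := fun i => M.weightBytes i / M.rate i with hb
  set c : ι → ℝ := fun i => δ i * M.dataBytes i / M.rate i with hc
  have hb0 : ∀ i, 0 < b i := fun i => div_pos (M.weightBytes_pos i) (hR i)
  have hc0 : ∀ i, 0 < c i := fun i => div_pos (mul_pos (hδ i) (M.dataBytes_pos i)) (hR i)
  have hcs : 0 < ∑ i, c i := Finset.sum_pos (fun i _ => hc0 i) Finset.univ_nonempty
  obtain ⟨T₁, hT₁, hsum⟩ := exists_gt_sum_div_sub_eq_one A b hb0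
  -- `T₁` uses up the uploading budget and `E + ∑ i, c i` the offloading budget. The larger one
  -- respects both and still uses up its own.
  set T := max T₁ (E + ∑ i, c i) with hT
  have hTA : ∀ i, 0 < T - A i := fun i => sub_pos.mpr ((hT₁ i).trans_le (le_max_left _ _))
  have hcE : ∑ i, c i ≤ T - E := by linarith [le_max_right T₁ (E + ∑ i, c i)]
  have hTE : 0 < T - E := hcs.trans_le hcE
  have hw0 : ∀ i, 0 < b i / (T - A i) := fun i => div_pos (hb0 i) (hTA i)
  have hv0 : ∀ i, 0 < c i / (T - E) := fun i => div_pos (hc0 i) hTE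
  have hvs : ∑ i, c i / (T - E) ≤ 1 := by
    rw [← Finset.sum_div]
    exact div_le_one_of_le₀ hcE hTE.le
  have hws : ∑ i, b i / (T - A i) ≤ 1 := by
    rw [← hsum]
    refine Finset.sum_le_sum fun i _ => div_le_div_of_nonneg_left (hb0 i).le
      (sub_pos.mpr (hT₁ i)) (sub_le_sub_right (le_max_left _ _) _)
  have hl : ∀ i, M.localTime i (δ i) (b i / (T - A i)) = (T : EReal) := fun i => by
    rw [localTime_eq_of_pos M (hw0 i), EReal.coe_eq_coe_iff]
    have h1 : M.weightBytes i / (b i / (T - A i) * M.rate i) = T - A i := by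
      have := (hR i).ne'
      have := (M.weightBytes_pos i).ne'
      have := (hTA i).ne'
      simp only [hb]
      field_simp
    rw [h1]
    exact add_sub_cancel (A i) T
  have he : ∀ i, M.edgeTime i δ (c i / (T - E)) = (T : EReal) := fun i => by
    rw [edgeTime_eq_of_pos M (hv0 i), EReal.coe_eq_coe_iff]
    have h1 : δ i * M.dataBytes i / (c i / (T - E) * M.rate i) = T - E := by
      have := (hR i).ne'
      have := (hδ i).ne'
      have := (M.dataBytes_pos i).ne'
      have := hTE.ne'
      simp only [hc]
      field_simp
    rw [h1]
    exact sub_add_cancel T E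
  have hfull : ∑ i, c i / (T - E) = 1 ∨ ∑ i, b i / (T - A i) = 1 := by
    rcases max_choice T₁ (E + ∑ i, c i) with h | h
    · right
      rw [hT, h, hsum]
    · left
      rw [← Finset.sum_div, hT, h, add_sub_cancel_left, div_self hcs.ne']
  refine ⟨⟨fun i => c i / (T - E), fun i => b i / (T - A i), δ⟩, T, rfl, ⟨?_, fun i => ?_⟩,
    fun i => ⟨hv0 i, hw0 i⟩⟩
  · exact M.solves_server_of_times_eq
      (x := ⟨fun i => c i / (T - E), fun i => b i / (T - A i), δ⟩) hδ
      ⟨hvs, hws, fun i => (hv0 i).le, fun i => (hw0 i).le⟩ hv0 hw0 hl he hfull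
  · exact M.solves_user_of_times_eq
      (x := ⟨fun i => c i / (T - E), fun i => b i / (T - A i), δ⟩) ⟨(hδ i).le, hδ1 i⟩
      (hv0 i) (hw0 i) (hl i) (he i)

end MECSystem

theorem theorem1 {ι : Type*} [Fintype ι] [DecidableEq ι] [Nonempty ι] (M : MECSystem ι) :
    -- the own strategy sets are convex and compact
    (Convex ℝ (MECSystem.serverSet ι) ∧ IsCompact (MECSystem.serverSet ι) ∧
      Convex ℝ MECSystem.userSet ∧ IsCompact MECSystem.userSet) ∧
    -- the coupled constraint sets are closed and convex, for all actions of the other players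
    ((∀ δ : ι → ℝ, (∀ i, δ i ∈ MECSystem.userSet) →
        IsClosed (M.serverCoupledSet δ) ∧ Convex ℝ (M.serverCoupledSet δ)) ∧
      ∀ x : Profile ι, (x.offBW, x.upBW) ∈ MECSystem.serverSet ι →
        (∀ j, x.offload j ∈ MECSystem.userSet) →
        ∀ i, IsClosed (M.userCoupledSet x i) ∧ Convex ℝ (M.userCoupledSet x i)) ∧
    -- the objective is continuous and convex in the variables of each player
    ((Continuous (MECSystem.objective ((ι → ℝ) × (ι → ℝ))) ∧
        ConvexOn ℝ Set.univ (MECSystem.objective ((ι → ℝ) × (ι → ℝ)))) ∧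
      Continuous (MECSystem.objective ℝ) ∧ ConvexOn ℝ Set.univ (MECSystem.objective ℝ)) ∧
    -- there is an equilibrium, and even one in which no user is denied bandwidth
    ∃ (x : Profile ι) (T : ℝ), M.IsGNE x T ∧ ∀ i, 0 < x.offBW i ∧ 0 < x.upBW i := by
  refine ⟨⟨MECSystem.convex_serverSet, MECSystem.isCompact_serverSet, convex_Icc 0 1,
    isCompact_Icc⟩, ⟨fun δ hδ => ⟨M.isClosed_serverCoupledSet fun i => (hδ i).1,
      M.convex_serverCoupledSet fun i => (hδ i).1⟩,
    fun x _ _ i => ⟨M.isClosed_userCoupledSet x i, M.convex_userCoupledSet x i⟩⟩,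
    ⟨⟨MECSystem.continuous_objective _, MECSystem.convexOn_objective _⟩,
      MECSystem.continuous_objective _, MECSystem.convexOn_objective _⟩, ?_⟩
  -- Any fractions in `(0, 1]` would do; their positivity makes the offloading shares positive.
  obtain ⟨x, T, -, hx, hpos⟩ :=
    M.exists_isGNE_of_offload (fun _ => 1 / 2) (fun _ => by norm_num) fun _ => by norm_num
  exact ⟨x, T, hx, hpos⟩
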